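/- Fix a universe of small sets; "small", "products", "directed colimits" etc. refer to it, and categories are locally small. Definitions. A category is accessible if for some (small) regular cardinal $\lambda$ it is $\lambda$-accessible, i.e. it has $\lambda$-directed colimits and a set of $\lambda$-presentable objects such that every object is a $\lambda$-directed colimit of objects of that set; it is finitely accessible if this holds for $\lambda=\aleph_0$. A category is weakly locally finitely presentable if it is finitely accessible and every small diagram in it has a weak colimit (a cocone through which every cocone factors, not necessarily uniquely). A category $\mathcal{L}$ is predefinable if it has small products and directed colimits, and products distribute over directed colimits: for every set $(\mathcal{D}_i\colon D_i\to\mathcal{L})_{i\in I}$ of diagrams indexed by small directed posets $D_i$, the canonical morphism $$\operatorname{colim}_{(d_i)\in\prod_i D_i}\ \prod_{i\in I}\mathcal{D}_i d_i\ \longrightarrow\ \prod_{i\in I}\operatorname{colim}\mathcal{D}_i$$ is an isomorphism. A category $\mathcal{L}$ is a complete prelocalization of a category $\mathcal{K}$ if it is (equivalent to) a reflective full subcategory of $\mathcal{K}$ whose reflector $\mathcal{K}\to\mathcal{L}$ preserves small products. Theorem. For a category $\mathcal{L}$ the following are equivalent: (1) $\mathcal{L}$ is accessible and predefinable; (2)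 $\mathcal{L}$ is accessible and there is a weakly locally finitely presentable category $\mathcal{K}$ such that $\mathcal{L}$ is a complete prelocalization of $\mathcal{K}$. -/

import Mathlib

open CategoryTheory CategoryTheory.Limits

universe w v v' u u'

namespace Predefinable

section

variable (L : Type u) [Category.{v} L]

/-- `L` has colimits of all diagrams indexed by `w`-small (non-empty) directed posets. -/
class HasDirectedColimits : Prop where
  hasColimitsOfShape (J : Type w) [PartialOrder J] [IsDirectedOrder J] [Nonempty J] :
    HasColimitsOfShape J L

attribute [instance] HasDirectedColimits.hasColimitsOfShape

/-- A product of directed posets, taken as a product category, is equivalent to the product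
poset, which is again directed. Hence a category with directed colimits has colimits of this
shape, so that the colimits of product diagrams below make sense. -/
instance hasColimitsOfShape_pi [HasDirectedColimits.{w} L] {I : Type w} (J : I → Type w)
    [∀ i, PartialOrder (J i)] [∀ i, IsDirectedOrder (J i)] [∀ i, Nonempty (J i)] :
    HasColimitsOfShape (∀ i, J i) L := by
  have hd : IsDirectedOrder (∀ i, J i) := ⟨fun a b ↦ by
    choose c hc using fun i ↦ exists_ge_ge (a i) (b i)
    exact ⟨c, fun i ↦ (hc i).1, fun i ↦ (hc i).2⟩⟩
  have h : @HasColimitsOfShape (∀ i, J i) (Preorder.smallCategory _) L _ :=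
    HasDirectedColimits.hasColimitsOfShape _
  let e : @CategoryTheory.Equivalence (∀ i, J i) (∀ i, J i) (Preorder.smallCategory _)
      (CategoryTheory.pi J) :=
    @CategoryTheory.Equivalence.mk' (∀ i, J i) (∀ i, J i) (Preorder.smallCategory _)
      (CategoryTheory.pi J)
      (@CategoryTheory.Functor.mk _ (Preorder.smallCategory _) _ _
        id (fun f i ↦ homOfLE (leOfHom f i)) (by intros; rfl) (by intros; rfl))
      (@CategoryTheory.Functor.mk _ _ _ (Preorder.smallCategory _)
        id (fun f ↦ homOfLE (fun i ↦ leOfHom (f i))) (by intros; rfl) (by intros; rfl))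
      (@Iso.refl _ (@Functor.category _ (Preorder.smallCategory _) _ (Preorder.smallCategory _)) _)
      (Iso.refl _) (by intros; rfl)
  exact @hasColimitsOfShape_of_equivalence _ (Preorder.smallCategory _) _ _ _ _ e h

/-- A category is predefinable if it has products and directed colimits, and products distribute
over directed colimits: for every set `(F i : J i ⥤ L)` of directed diagrams in `L`, the canonical
morphism `colim_k ∏ᵢ F i (k i) ⟶ ∏ᵢ colim (F i)`, where `k` ranges over the product of the posets
`J i`, is an isomorphism. -/
structure IsPredefinable : Prop where
  hasProducts : HasProducts.{w} L
  hasDirectedColimits : HasDirectedColimits.{w} L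
  isIso_canonical (I : Type w) (J : I → Type w) [∀ i, PartialOrder (J i)]
    [∀ i, IsDirectedOrder (J i)] [∀ i, Nonempty (J i)] (F : ∀ i, J i ⥤ L) :
    IsIso (colimitPointwiseProductToProductColimit F)

/-- `L` has weak colimits of all `w`-small diagrams: every diagram has a cocone through which
every other cocone factors (not necessarily uniquely). -/
def HasWeakColimits : Prop :=
  ∀ (J : Type w) [SmallCategory J] (F : J ⥤ L), ∃ c : Cocone F, ∀ s : Cocone F, Nonempty (c ⟶ s)

/-- A category is weakly locally finitely presentable if it is finitely accessible
and has weak colimits. -/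
structure IsWeaklyLocallyFinitelyPresentable : Prop where
  isFinitelyAccessible : IsFinitelyAccessibleCategory.{w} L
  hasWeakColimits : HasWeakColimits.{w} L

end

/-- A functor `i : L ⥤ K` exhibits `L` as a complete prelocalization of `K` if it is fully
faithful and has a left adjoint (so that `L` is, up to equivalence, a reflective full subcategory
of `K`) and if the left adjoint preserves products. -/
def IsCompletePrelocalization {L : Type u} [Category.{v} L] {K : Type u'} [Category.{v'} K]
    (i : L ⥤ K) : Prop :=
  ∃ _ : Reflective i, ∀ I : Type w, PreservesLimitsOfShape (Discrete I) (reflector i)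

end Predefinable

/-! Accessibility occurs on both sides, so only distributivity and the prelocalization are at stake.
If `L` is accessible, let `G : A ⥤ L` be the small dense subcategory of presentable objects. Then `X
↦ Hom(G -, X)` embeds `L` fully into `Ind(A)`, and its left adjoint `R` sends a directed colimit of
representables to the same colimit of objects `G a`. `Ind(A)` is closed under products of
presheaves, because a product of representables is the image of a product in `L`. It has weak
colimits because, by a Löwenheim–Skolem argument (`exists_flat_subfunctor`), every cocone factors
through one from a small set, and the product of that set is weakly initial.

Products distribute over directed colimits in sets, hence in `Ind(A)`. Applying `R` to `∏ Wᵢ = colim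
∏ y(aᵢ)` gives `colim ∏ G aᵢ`, and distributivity in `L` says that this is `∏ R Wᵢ`. Conversely,
weak colimits in `K` make products of representables ind-objects, so `K` sits in presheaves closed
under products and filtered colimits and inherits distributivity; a product-preserving reflector
carries it to `L`.

Both transfers use `ProductCocone`, which allows arbitrary rather than chosen products and so is
stable under suitable functors. `nonempty_isColimit` and `nonempty_isLimit` trade its limit property
for its colimit property. -/

namespace Predefinable

/-! ### Products against directed colimits, up to isomorphism -/

/-- A family of functors `F i`, colimit cocones `c i` of them, a functor `P` computing the pointwise
products of the `F i`, and a cocone on `P` whose point `Q` is equipped with compatible projections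
to the points of the `c i`. -/
structure ProductCocone {C : Type u} [Category.{v} C] {I : Type w} {J : I → Type w}
    [∀ i, Category.{w} (J i)] (F : ∀ i, J i ⥤ C) where
  P : (∀ i, J i) ⥤ C
  π (k : ∀ i, J i) (i : I) : P.obj k ⟶ (F i).obj (k i)
  map_π {k l : ∀ i, J i} (f : k ⟶ l) (i : I) : P.map f ≫ π l i = π k i ≫ (F i).map (f i)
  isLimit (k : ∀ i, J i) : IsLimit (Fan.mk (P.obj k) (π k))
  c (i : I) : Cocone (F i)
  isColimit (i : I) : IsColimit (c i)
  Q : C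
  proj (i : I) : Q ⟶ (c i).pt
  ι (k : ∀ i, J i) : P.obj k ⟶ Q
  map_ι {k l : ∀ i, J i} (f : k ⟶ l) : P.map f ≫ ι l = ι k
  w (k : ∀ i, J i) (i : I) : ι k ≫ proj i = π k i ≫ (c i).ι.app (k i)

namespace ProductCocone

variable {C : Type u} [Category.{v} C] {I : Type w} {J : I → Type w}
    [∀ i, Category.{w} (J i)] {F F' : ∀ i, J i ⥤ C}

/-- The cocone on the pointwise products. -/
abbrev cocone (d : ProductCocone F) : Cocone d.P :=
  ⟨d.Q, { app := d.ι, naturality _ _ f := by simp [d.map_ι f] }⟩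

/-- The fan of projections. -/
abbrev fan (d : ProductCocone F) : Fan (fun i ↦ (d.c i).pt) := Fan.mk d.Q d.proj

/-- The image of a `ProductCocone` under a functor. -/
@[simps P c Q proj ι]
noncomputable def postcomp {D : Type u'} [Category.{v'} D] (d : ProductCocone F) (E : C ⥤ D)
    [∀ i, PreservesColimitsOfShape (J i) E]
    (h : ∀ k, IsLimit (Fan.mk (E.obj (d.P.obj k)) (fun i ↦ E.map (d.π k i)))) :
    ProductCocone (fun i ↦ F i ⋙ E) where
  P := d.P ⋙ E
  π k i := E.map (d.π k i)
  map_π f i := by simp only [Functor.comp_map, ← E.map_comp, map_π]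
  isLimit := h
  c i := E.mapCocone (d.c i)
  isColimit i := isColimitOfPreserves E (d.isColimit i)
  Q := E.obj d.Q
  proj i := E.map (d.proj i)
  ι k := E.map (d.ι k)
  map_ι f := by simp only [Functor.comp_map, ← E.map_comp, map_ι]
  w k i := (E.map_comp _ _).symm.trans ((congrArg E.map (d.w k i)).trans (E.map_comp _ _))

section

variable {D : Type u'} [Category.{v'} D] (d : ProductCocone F) (E : C ⥤ D)
    [∀ i, PreservesColimitsOfShape (J i) E]
    (h : ∀ k, IsLimit (Fan.mk (E.obj (d.P.obj k)) (fun i ↦ E.map (d.π k i))))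

/-- The cocone of the image is the image of the cocone. -/
noncomputable def postcompCoconeIso : E.mapCocone d.cocone ≅ (d.postcomp E h).cocone :=
  Cocone.ext (Iso.refl _) fun _ ↦ Category.comp_id _

end

/-- The `ProductCocone` whose underlying cocone is induced by a limit fan. -/
@[simps P c Q proj]
noncomputable def ofFan (P : (∀ i, J i) ⥤ C) (π : ∀ k i, P.obj k ⟶ (F i).obj (k i))
    (map_π : ∀ {k l : ∀ i, J i} (f : k ⟶ l) (i : I), P.map f ≫ π l i = π k i ≫ (F i).map (f i))
    (isLimit : ∀ k : ∀ i, J i, IsLimit (Fan.mk (P.obj k) (π k))) (c : ∀ i, Cocone (F i))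
    (isColimit : ∀ i, IsColimit (c i)) (fan : Fan (fun i ↦ (c i).pt)) (hfan : IsLimit fan) :
    ProductCocone F where
  P := P
  π := π
  map_π := map_π
  isLimit := isLimit
  c := c
  isColimit := isColimit
  Q := fan.pt
  proj := fan.proj
  ι k := Fan.IsLimit.lift hfan fun i ↦ π k i ≫ (c i).ι.app (k i)
  map_ι {k l} f := Fan.IsLimit.hom_ext hfan _ _ fun i ↦ by
    have := (c i).w (f i)
    simp [reassoc_of% map_π f i, this]
  w k i := Fan.IsLimit.fac hfan _ _

lemma coconePointwiseProduct_ι_app [HasProductsOfShape I C] (c : ∀ i, Cocone (F i))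
    (k : ∀ i, J i) :
    (coconePointwiseProduct c).ι.app k = Limits.Pi.map fun i ↦ (c i).ι.app (k i) :=
  Category.comp_id _

/-- The canonical `ProductCocone`, built from chosen products. -/
@[simps P c Q proj ι]
noncomputable def canonical [HasProductsOfShape I C] (c : ∀ i, Cocone (F i))
    (hc : ∀ i, IsColimit (c i)) : ProductCocone F where
  P := pointwiseProduct F
  π k i := Pi.π (fun i ↦ (F i).obj (k i)) i
  map_π f i := Pi.map_π _ _
  isLimit k := productIsProduct _
  c := c
  isColimit := hc
  Q := ∏ᶜ fun i ↦ (c i).pt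
  proj i := Pi.π _ i
  ι := (coconePointwiseProduct c).ι.app
  map_ι f := (coconePointwiseProduct c).w f
  w k i := by
    rw [coconePointwiseProduct_ι_app]
    exact Pi.map_π (fun i ↦ (c i).ι.app (k i)) i

variable (d : ProductCocone F) (d' : ProductCocone F') (α : ∀ i, F i ≅ F' i)

/-- Pointwise products of isomorphic families, at an object. -/
noncomputable def prodObjIso (k : ∀ i, J i) : d.P.obj k ≅ d'.P.obj k :=
  IsLimit.conePointsIsoOfNatIso (d.isLimit k) (d'.isLimit k)
    (Discrete.natIso fun i ↦ (α i.as).app (k i.as))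

lemma prodObjIso_hom_π (k : ∀ i, J i) (i : I) :
    (prodObjIso d d' α k).hom ≫ d'.π k i = d.π k i ≫ (α i).hom.app (k i) :=
  IsLimit.conePointsIsoOfNatIso_hom_comp (d.isLimit k) (d'.isLimit k)
        (Discrete.natIso fun i ↦ (α i.as).app (k i.as)) ⟨i⟩

/-- Pointwise products of isomorphic families are isomorphic. -/
noncomputable def prodIso : d.P ≅ d'.P :=
  NatIso.ofComponents (prodObjIso d d' α) (fun {k l} f ↦ by
      refine Fan.IsLimit.hom_ext (d'.isLimit l) _ _ fun i ↦ ?_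
      simp [Fan.proj, prodObjIso_hom_π, map_π, reassoc_of% d.map_π f i,
        reassoc_of% prodObjIso_hom_π d d' α k i])

/-- The colimits of isomorphic families are isomorphic. -/
noncomputable def colimitIso (i : I) : (d.c i).pt ≅ (d'.c i).pt :=
  IsColimit.coconePointsIsoOfNatIso (d.isColimit i) (d'.isColimit i) (α i)

lemma ι_colimitIso_hom (i : I) (j : J i) :
    (d.c i).ι.app j ≫ (colimitIso d d' α i).hom = (α i).hom.app j ≫ (d'.c i).ι.app j :=
  IsColimit.comp_coconePointsIsoOfNatIso_hom _ _ _ _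

variable {d'} in
/-- The comparison of the points of the fans. -/
noncomputable def comparison (hl' : IsLimit d'.fan) : d.Q ⟶ d'.Q :=
  Fan.IsLimit.lift hl' (fun i ↦ d.proj i ≫ (colimitIso d d' α i).hom)

lemma comparison_proj (hl' : IsLimit d'.fan) (i : I) :
    comparison d α hl' ≫ d'.proj i = d.proj i ≫ (colimitIso d d' α i).hom :=
  Fan.IsLimit.fac hl' _ _

lemma ι_comparison (hl' : IsLimit d'.fan) (k : ∀ i, J i) :
    d.ι k ≫ comparison d α hl' = (prodObjIso d d' α k).hom ≫ d'.ι k := by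
  refine Fan.IsLimit.hom_ext hl' _ _ fun i ↦ ?_
  have h1 := comparison_proj d d' α hl' i
  have h2 := ι_colimitIso_hom d d' α i (k i)
  have h3 := prodObjIso_hom_π d d' α k i
  dsimp at h2
  simp [Fan.proj, h1, reassoc_of% d.w k i, h2, w, reassoc_of% h3]

variable {d d'}

lemma isIso_comparison_of_isLimit (hl : IsLimit d.fan) (hl' : IsLimit d'.fan) :
    IsIso (comparison d α hl') := by
  have : comparison d α hl' = (IsLimit.conePointsIsoOfNatIso hl hl'
      (Discrete.natIso fun i ↦ colimitIso d d' α i.as)).hom := by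
    refine Fan.IsLimit.hom_ext hl' _ _ fun i ↦ ?_
    exact (comparison_proj d d' α hl' i).trans (IsLimit.conePointsIsoOfNatIso_hom_comp hl hl'
      (Discrete.natIso fun i ↦ colimitIso d d' α i.as) ⟨i⟩).symm
  rw [this]
  infer_instance

include α

/-- If both fans are limits, then one cocone is colimiting if the other is. -/
theorem nonempty_isColimit (hl : IsLimit d.fan) (hl' : IsLimit d'.fan)
    (h : IsColimit d.cocone) : Nonempty (IsColimit d'.cocone) := by
  have := isIso_comparison_of_isLimit α hl hl'
  refine ⟨(IsColimit.precomposeHomEquiv (prodIso d d' α) _).1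
    (IsColimit.ofIsoColimit h (Cocone.ext (asIso (comparison d α hl')) fun k ↦ ?_))⟩
  exact ι_comparison d d' α hl' k

/-- If both cocones are colimiting, then one fan is limiting if the other is. -/
theorem nonempty_isLimit (hl' : IsLimit d'.fan) (h : IsColimit d.cocone)
    (h' : IsColimit d'.cocone) : Nonempty (IsLimit d.fan) := by
  -- The comparison agrees on coprojections with the isomorphism between the two colimits, so it is
  -- invertible.
  have : comparison d α hl' = (IsColimit.coconePointsIsoOfNatIso h h' (prodIso d d' α)).hom := by
    refine h.hom_ext fun k ↦ ?_
    rw [IsColimit.comp_coconePointsIsoOfNatIso_hom]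
    exact ι_comparison d d' α hl' k
  have : IsIso (comparison d α hl') := by rw [this]; infer_instance
  refine ⟨(IsLimit.postcomposeHomEquiv (Discrete.natIso fun i ↦ colimitIso d d' α i.as) _).1
    (IsLimit.ofIsoLimit hl' (Cone.ext (asIso (comparison d α hl')) fun i ↦ ?_).symm)⟩
  exact (comparison_proj d d' α hl' i.as).symm

omit α

/-- The canonical morphism is the descent map from the chosen colimit to this cocone; this links
`ProductCocone` to the definition of predefinability. -/
lemma isColimit_canonical_iff [HasProductsOfShape I C] [∀ i, HasColimit (F i)]
    [HasColimit (pointwiseProduct F)] :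
    Nonempty (IsColimit (canonical (fun i ↦ colimit.cocone (F i))
      (fun _ ↦ colimit.isColimit _)).cocone) ↔
        IsIso (colimitPointwiseProductToProductColimit F) :=
  (colimit.isColimit (pointwiseProduct F)).nonempty_isColimit_iff_isIso_desc

/-- The fan of the canonical `ProductCocone` is limiting. -/
noncomputable def isLimitCanonicalFan [HasProductsOfShape I C] (c : ∀ i, Cocone (F i))
    (hc : ∀ i, IsColimit (c i)) : IsLimit (canonical c hc).fan :=
  productIsProduct _

/-- Products distribute over filtered colimits in a category which embeds into a category with this
property, provided that the embedding preserves products and the relevant colimits. -/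
theorem nonempty_isColimit_of_fullyFaithful {J : I → Type w} [∀ i, SmallCategory (J i)]
    [∀ i, IsFiltered (J i)] {F : ∀ i, J i ⥤ C} {D : Type u'}
    [Category.{v'} D] [HasProductsOfShape I D] [IsIPCOfShape.{w} I D] (E : C ⥤ D) [E.Full]
    [E.Faithful] [PreservesLimitsOfShape (Discrete I) E]
    [∀ i, PreservesColimitsOfShape (J i) E] (d : ProductCocone F) (hd : IsLimit d.fan) :
    Nonempty (IsColimit d.cocone) := by
  let d' := d.postcomp E fun k ↦ isLimitFanMkObjOfIsLimit E _ _ (d.isLimit k)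
  obtain ⟨h⟩ := IsIPCOfShape.nonempty_isColimit d'.isColimit
  obtain ⟨h'⟩ := nonempty_isColimit (d := canonical d'.c d'.isColimit) (d' := d')
    (fun _ ↦ Iso.refl _) (isLimitCanonicalFan _ _) (isLimitFanMkObjOfIsLimit E _ _ hd) h
  exact ⟨isColimitOfReflects E (IsColimit.ofIsoColimit h' (postcompCoconeIso d E _).symm)⟩

end ProductCocone

open Opposite

/-! ### Ind-objects as flat presheaves -/

section

variable {A : Type w} [SmallCategory A]

/-- An elementwise formulation of the filteredness of the category of elements of a presheaf. -/
structure IsFlat (W : Aᵒᵖ ⥤ Type w) : Prop where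
  nonempty : ∃ a, Nonempty (W.obj (op a))
  pair {a b : A} (x : W.obj (op a)) (y : W.obj (op b)) :
    ∃ (c : A) (z : W.obj (op c)) (f : a ⟶ c) (g : b ⟶ c), W.map f.op z = x ∧ W.map g.op z = y
  coeq {a b : A} (f g : a ⟶ b) (y : W.obj (op b)) (h : W.map f.op y = W.map g.op y) :
    ∃ (c : A) (z : W.obj (op c)) (k : b ⟶ c), W.map k.op z = y ∧ f ≫ k = g ≫ k

/-- The object of the category of elements given by an element. -/
abbrev mkElement (W : Aᵒᵖ ⥤ Type w) {a : A} (x : W.obj (op a)) : CostructuredArrow yoneda W :=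
  CostructuredArrow.mk (yonedaEquiv.symm x)

/-- The element corresponding to an object of the category of elements. -/
abbrev element {W : Aᵒᵖ ⥤ Type w} (X : CostructuredArrow yoneda W) : W.obj (op X.left) :=
  yonedaEquiv X.hom

lemma yoneda_map_comp_iff {W : Aᵒᵖ ⥤ Type w} {X Y : CostructuredArrow yoneda W}
    (f : X.left ⟶ Y.left) :
    yoneda.map f ≫ Y.hom = X.hom ↔ W.map f.op (element Y) = element X := by
  rw [← yonedaEquiv.injective.eq_iff, ← yonedaEquiv_naturality]

/-- A morphism in the category of elements. -/
abbrev homMkElement {W : Aᵒᵖ ⥤ Type w} {X Y : CostructuredArrow yoneda W}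
    (f : X.left ⟶ Y.left) (h : W.map f.op (element Y) = element X) : X ⟶ Y :=
  CostructuredArrow.homMk f ((yoneda_map_comp_iff f).2 h)

lemma map_element {W : Aᵒᵖ ⥤ Type w} {X Y : CostructuredArrow yoneda W} (f : X ⟶ Y) :
    W.map f.left.op (element Y) = element X :=
  (yoneda_map_comp_iff _).1 (CostructuredArrow.w f)

@[simp]
lemma element_mkElement (W : Aᵒᵖ ⥤ Type w) {a : A} (x : W.obj (op a)) :
    element (mkElement W x) = x :=
  yonedaEquiv.apply_symm_apply x

/-- Smallness is automatic as `A` is small, so only filteredness of the category of elements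
matters. Spelled out on elements, it can be checked in subfunctors. -/
theorem isIndObject_iff_isFlat (W : Aᵒᵖ ⥤ Type w) : IsIndObject W ↔ IsFlat W := by
  constructor
  · intro h
    have := h.isFiltered
    refine ⟨?_, fun {a b} x y ↦ ?_, fun {a b} f g y h ↦ ?_⟩
    · obtain ⟨X⟩ := IsFiltered.nonempty (C := CostructuredArrow yoneda W)
      exact ⟨_, ⟨element X⟩⟩
    · obtain ⟨Z, f, g, -⟩ := IsFilteredOrEmpty.cocone_objs (mkElement W x) (mkElement W y)
      exact ⟨_, element Z, f.left, g.left, by simpa using map_element f,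
        by simpa using map_element g⟩
    · let f' : mkElement W (W.map f.op y) ⟶ mkElement W y := homMkElement f (by simp)
      let g' : mkElement W (W.map f.op y) ⟶ mkElement W y := homMkElement g (by simp [h])
      obtain ⟨Z, k, hk⟩ := IsFilteredOrEmpty.cocone_maps f' g'
      exact ⟨_, element Z, k.left, by simpa using map_element k, congrArg CommaMorphism.left hk⟩
  · intro h
    rw [isIndObject_iff]
    have := essentiallySmallSelf (CostructuredArrow yoneda W)
    refine ⟨?_, finallySmall_of_essentiallySmall _⟩
    have : IsFilteredOrEmpty (CostructuredArrow yoneda W) := by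
      refine ⟨fun X Y ↦ ?_, fun X Y f g ↦ ?_⟩
      · obtain ⟨c, z, f, g, hf, hg⟩ := h.pair (element X) (element Y)
        exact ⟨mkElement W z, homMkElement f (by simp [hf]), homMkElement g (by simp [hg]),
          trivial⟩
      · obtain ⟨c, z, k, hk, hk'⟩ := h.coeq f.left g.left (element Y)
          ((map_element f).trans (map_element g).symm)
        exact ⟨mkElement W z, homMkElement k (by simp [hk]), by ext; exact hk'⟩
    obtain ⟨a, ⟨x⟩⟩ := h.nonempty
    exact { nonempty := ⟨mkElement W x⟩ }

end

/-! ### Dense functors and the restricted Yoneda embedding -/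

section

variable {A : Type w} [SmallCategory A] {C : Type u} [Category.{w} C] (G : A ⥤ C)

/-- The restricted Yoneda functor, sending `X` to `a ↦ (G a ⟶ X)`. -/
abbrev restrictedYoneda : C ⥤ Aᵒᵖ ⥤ Type w :=
  yoneda ⋙ (Functor.whiskeringLeft _ _ _).obj G.op

instance [G.IsDense] : (restrictedYoneda G).Faithful where
  map_injective {X Y f g} h := (G.denseAt X).hom_ext' fun a p ↦ by
    exact congrArg (𝟙 _ ≫ ·) (ConcreteCategory.congr_hom (NatTrans.congr_app h (op a)) p)

/-- A natural transformation `Hom(G -, X) ⟶ Hom(G -, Y)` is a cocone with point `Y` on the canonical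
diagram of `X`, whose colimit is `X` by density. -/
instance [G.IsDense] : (restrictedYoneda G).Full where
  map_surjective {X Y} f := by
    let c : Cocone (CostructuredArrow.proj G X ⋙ G) :=
      { pt := Y
        ι :=
          { app g := f.app (op g.left) g.hom
            naturality g₁ g₂ φ := by
              have := ConcreteCategory.congr_hom (f.naturality φ.left.op) g₂.hom
              refine Eq.trans ?_ (Category.comp_id _).symm
              exact this.symm.trans (congrArg (f.app (op g₁.left)) (CostructuredArrow.w φ)) } }
    refine ⟨(G.denseAt X).desc c, ?_⟩
    ext ⟨a⟩ x
    exact (congrArg (· ≫ (G.denseAt X).desc c) (Category.id_comp x)).symm.trans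
      ((G.denseAt X).fac c (.mk x))

lemma preservesColimitsOfShape_restrictedYoneda (J : Type w) [SmallCategory J]
    [∀ a, PreservesColimitsOfShape J (coyoneda.obj (op (G.obj a)))] :
    PreservesColimitsOfShape J (restrictedYoneda G) :=
  preservesColimitsOfShape_of_evaluation _ _ fun a ↦
    inferInstanceAs (PreservesColimitsOfShape J (coyoneda.obj (op (G.obj a.unop))))

/-- For a fully faithful functor, the restricted Yoneda functor extends the Yoneda embedding. -/
noncomputable def compRestrictedYonedaIso [G.Full] [G.Faithful] :
    G ⋙ restrictedYoneda G ≅ yoneda :=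
  NatIso.ofComponents (fun a ↦ NatIso.ofComponents
      (fun b ↦ ((Functor.FullyFaithful.ofFullyFaithful G).homEquiv (X := b.unop) (Y := a)).symm.toIso)
      (fun f ↦ by
        ext x
        apply G.map_injective
        simp [Functor.FullyFaithful.homEquiv]))
    (fun f ↦ by
      ext b x
      apply G.map_injective
      simp [Functor.FullyFaithful.homEquiv])

/-- The elements of `Hom(G -, X)` are the objects of the comma category of `G` over `X`, so its
filteredness translates clause by clause. -/
lemma isIndObject_restrictedYoneda (X : C)
    [IsFiltered (CostructuredArrow G X)] : IsIndObject ((restrictedYoneda G).obj X) := by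
  rw [isIndObject_iff_isFlat]
  refine ⟨?_, fun {a b} x y ↦ ?_, fun {a b} f g y h ↦ ?_⟩
  · obtain ⟨Y⟩ := IsFiltered.nonempty (C := CostructuredArrow G X)
    exact ⟨Y.left, ⟨Y.hom⟩⟩
  · obtain ⟨Z, f, g, -⟩ := IsFilteredOrEmpty.cocone_objs
      (CostructuredArrow.mk (S := G) (T := X) x) (CostructuredArrow.mk (S := G) (T := X) y)
    exact ⟨_, Z.hom, f.left, g.left, CostructuredArrow.w f, CostructuredArrow.w g⟩
  · let f' : CostructuredArrow.mk (S := G) (T := X) (G.map f ≫ y) ⟶ CostructuredArrow.mk y :=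
      CostructuredArrow.homMk f
    let g' : CostructuredArrow.mk (S := G) (T := X) (G.map f ≫ y) ⟶ CostructuredArrow.mk y :=
      CostructuredArrow.homMk g h.symm
    obtain ⟨Z, k, hk⟩ := IsFilteredOrEmpty.cocone_maps f' g'
    exact ⟨_, Z.hom, k.left, CostructuredArrow.w k, congrArg CommaMorphism.left hk⟩

variable (C) in
/-- An accessible category admits a dense functor from a small category of presentable objects. -/
lemma exists_dense_functor (κ : Cardinal.{w}) [Fact κ.IsRegular]
    [IsCardinalAccessibleCategory C κ] :
    ∃ (A : Type w) (_ : SmallCategory A) (G : A ⥤ C), G.Full ∧ G.Faithful ∧ G.IsDense ∧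
      (∀ a, IsCardinalPresentable (G.obj a) κ) ∧ ∀ X, IsFiltered (CostructuredArrow G X) := by
  let P := isCardinalPresentable C κ
  let e := equivSmallModel.{w} P.FullSubcategory
  refine ⟨SmallModel.{w} P.FullSubcategory, inferInstance, e.inverse ⋙ P.ι, inferInstance,
    inferInstance, inferInstance, fun a ↦ (e.inverse.obj a).property, fun X ↦ ?_⟩
  have : IsFiltered (CostructuredArrow P.ι X) := isFiltered_of_isCardinalFiltered _ κ
  exact IsFiltered.of_equivalence (CostructuredArrow.pre e.inverse P.ι X).asEquivalence.symm

end

/-! ### The finitely accessible category of ind-objects -/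

section

variable (A : Type w) [SmallCategory A]

/-- The category of ind-objects, as a full subcategory of presheaves. -/
abbrev IndObj : Type (w + 1) := ObjectProperty.FullSubcategory (IsIndObject (C := A))

/-- The inclusion of ind-objects into presheaves. -/
abbrev IndObj.inclusion : IndObj A ⥤ Aᵒᵖ ⥤ Type w := ObjectProperty.ι (IsIndObject (C := A))

/-- The Yoneda embedding into ind-objects. -/
abbrev IndObj.yoneda : A ⥤ IndObj A :=
  ObjectProperty.lift (IsIndObject (C := A)) CategoryTheory.yoneda isIndObject_yoneda

variable {A}

/-- Maps from representables are elements. -/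
noncomputable def coyonedaObjYonedaIso (a : A) :
    coyoneda.obj (op ((IndObj.yoneda A).obj a)) ≅
      IndObj.inclusion A ⋙ (evaluation _ _).obj (op a) :=
  NatIso.ofComponents (fun W ↦ ((ObjectProperty.fullyFaithfulι _).homEquiv.trans
    yonedaEquiv).toIso) (fun f ↦ by ext x; rfl)

lemma preservesColimitsOfShape_coyoneda_yoneda (a : A) (J : Type w) [SmallCategory J]
    [IsFiltered J] :
    PreservesColimitsOfShape J (coyoneda.obj (op ((IndObj.yoneda A).obj a))) :=
  preservesColimitsOfShape_of_natIso (coyonedaObjYonedaIso a).symm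

/-- An ind-object is a directed colimit of representables. -/
lemma IndObj.exists_directed (X : IndObj A) :
    ∃ (J : Type w) (_ : PartialOrder J) (_ : IsDirectedOrder J) (_ : Nonempty J)
      (Φ : J ⥤ A) (c : Cocone (Φ ⋙ IndObj.yoneda A)), c.pt = X ∧ Nonempty (IsColimit c) := by
  obtain ⟨p⟩ := X.property.nonempty_presentation
  obtain ⟨J, _, _, _, Φ, _⟩ := IsFiltered.exists_directed p.I
  refine ⟨J, _, inferInstance, inferInstance, Φ ⋙ p.F,
    { pt := X, ι := { app j := ⟨p.ι.app (Φ.obj j)⟩, naturality i j f := ?_ } }, rfl,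
    ⟨isColimitOfReflects (IndObj.inclusion A)
      ((Functor.Final.isColimitWhiskerEquiv Φ p.cocone).symm p.isColimit)⟩⟩
  ext : 1
  exact p.ι.naturality (Φ.map f)

attribute [local instance] Cardinal.fact_isRegular_aleph0

variable (A) in
theorem isFinitelyAccessibleCategory_indObj : IsFinitelyAccessibleCategory.{w} (IndObj A) := by
  have h : (ObjectProperty.ofObj (IndObj.yoneda A).obj).IsCardinalFilteredGenerator
      Cardinal.aleph0.{w} := by
    refine ⟨?_, fun X ↦ ?_⟩
    · rintro _ ⟨a⟩
      refine ⟨fun J _ _ ↦ ?_⟩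
      have : IsFiltered J := isFiltered_of_isCardinalFiltered J Cardinal.aleph0
      exact preservesColimitsOfShape_coyoneda_yoneda a J
    · obtain ⟨J, _, _, _, Φ, c, rfl, ⟨hc⟩⟩ := X.exists_directed
      exact ⟨J, inferInstance, (isCardinalFiltered_aleph0_iff J).2 inferInstance,
        ⟨{ diag := Φ ⋙ IndObj.yoneda A, ι := c.ι, isColimit := hc,
           prop_diag_obj j := ⟨Φ.obj j⟩ }⟩⟩
  have := h.hasCardinalFilteredGenerator
  have : HasCardinalFilteredColimits.{w} (IndObj A) Cardinal.aleph0 := ⟨fun J _ _ ↦ by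
    have : IsFiltered J := isFiltered_of_isCardinalFiltered J Cardinal.aleph0
    infer_instance⟩
  exact { }

end

/-! ### Löwenheim–Skolem for flat presheaves and weak colimits -/

/-- Terms built from a set of constants, a constant, a family of unary operations, and a binary
operation. -/
inductive Term (T Op : Type w) : Type w
  | base (t : T) : Term T Op
  | pt : Term T Op
  | un (o : Op) (x : Term T Op) : Term T Op
  | bin (x y : Term T Op) : Term T Op

/-- The evaluation of terms. -/
def Term.eval {T Op : Type w} {E : Type u} (base : T → E) (pt : E) (un : Op → E → E)
    (bin : E → E → E) : Term T Op → E
  | .base t => base t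
  | .pt => pt
  | .un o x => un o (x.eval base pt un bin)
  | .bin x y => bin (x.eval base pt un bin) (y.eval base pt un bin)

section

variable (A : Type w) [SmallCategory A]

/-- The index set of unary operations on the elements of a flat presheaf: restrictions and
choices of equalizing elements. -/
abbrev UnaryOp : Type w := (Σ a b : A, a ⟶ b) ⊕ (Σ a b : A, (a ⟶ b) × (a ⟶ b))

/-- The elements of a presheaf. -/
abbrev Element {A : Type w} [SmallCategory A] (W : Aᵒᵖ ⥤ Type w) : Type w := Σ a : A, W.obj (op a)

variable {A}

/-- Restriction along a morphism, as a totally defined operation. -/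
lemma exists_restriction (W : Aᵒᵖ ⥤ Type w) (o : Σ a b : A, a ⟶ b) :
    ∃ r : Element W → Element W, ∀ y : W.obj (op o.2.1), r ⟨_, y⟩ = ⟨_, W.map o.2.2.op y⟩ := by
  classical
  -- Elements not lying over the target of `o` are left fixed; this value is never used.
  refine ⟨fun x ↦ if h : o.2.1 = x.1 then ⟨o.1, W.map o.2.2.op (h ▸ x.2)⟩ else x, fun y ↦ ?_⟩
  simp

/-- Skolemizes the equalizing clause of flatness as a total operation, so that closure under it can
be expressed by terms. -/
lemma exists_equalizing {W : Aᵒᵖ ⥤ Type w} (hW : IsFlat W) (o : Σ a b : A, (a ⟶ b) × (a ⟶ b)) :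
    ∃ r : Element W → Element W, ∀ y : W.obj (op o.2.1),
      W.map o.2.2.1.op y = W.map o.2.2.2.op y →
      ∃ (k : o.2.1 ⟶ (r ⟨_, y⟩).1), W.map k.op (r ⟨_, y⟩).2 = y ∧ o.2.2.1 ≫ k = o.2.2.2 ≫ k := by
  have (x : Element W) : ∃ z : Element W, ∀ y : W.obj (op o.2.1), x = ⟨_, y⟩ →
      W.map o.2.2.1.op y = W.map o.2.2.2.op y →
      ∃ (k : o.2.1 ⟶ z.1), W.map k.op z.2 = y ∧ o.2.2.1 ≫ k = o.2.2.2 ≫ k := by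
    by_cases h : ∃ y : W.obj (op o.2.1), x = ⟨_, y⟩ ∧ W.map o.2.2.1.op y = W.map o.2.2.2.op y
    · obtain ⟨y, rfl, hy⟩ := h
      obtain ⟨c, z, k, hk⟩ := hW.coeq _ _ y hy
      refine ⟨⟨c, z⟩, fun y' hy' _ ↦ ⟨k, ?_⟩⟩
      obtain rfl : y = y' := by simpa using hy'
      exact hk
    · exact ⟨x, fun y hy hy' ↦ (h ⟨y, hy, hy'⟩).elim⟩
  choose r hr using this
  exact ⟨r, fun y ↦ hr _ y rfl⟩

/-- A downward Löwenheim-Skolem theorem for flat presheaves: a small family of elements is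
contained in a flat subfunctor, with a bound on its size that only depends on the family. -/
theorem exists_flat_subfunctor {W : Aᵒᵖ ⥤ Type w} (hW : IsFlat W) {T : Type w}
    (b : T → Element W) :
    ∃ W' : Subfunctor W, IsFlat W'.toFunctor ∧ (∀ t, (b t).2 ∈ W'.obj (op (b t).1)) ∧
      ∃ s : Term T (UnaryOp A) → Element W'.toFunctor, Function.Surjective s := by
  obtain ⟨a₀, ⟨x₀⟩⟩ := hW.nonempty
  choose res hres using exists_restriction W
  choose eq heq using exists_equalizing hW
  choose bc bz bf bg hbf hbg using fun (x y : Element W) ↦ hW.pair x.2 y.2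
  let ev : Term T (UnaryOp A) → Element W :=
    Term.eval b ⟨a₀, x₀⟩ (Sum.elim res eq) (fun x y ↦ ⟨bc x y, bz x y⟩)
  -- The values of all terms: closed under restriction, pairing and equalizing, hence flat. The set
  -- of terms does not depend on `W`, which bounds the size.
  let W' : Subfunctor W :=
    { obj a := {x | (⟨a.unop, x⟩ : Element W) ∈ Set.range ev}
      map {a a'} f x := by
        rintro ⟨t, ht⟩
        refine ⟨.un (.inl ⟨_, _, f.unop⟩) t, ?_⟩
        change res _ (ev t) = _
        rw [ht]
        exact hres ⟨_, _, f.unop⟩ x }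
  have mem (t) : (ev t).2 ∈ W'.obj (op (ev t).1) := ⟨t, rfl⟩
  refine ⟨W', ⟨?_, ?_, ?_⟩, fun t ↦ ⟨.base t, rfl⟩, fun t ↦ ⟨(ev t).1, ⟨(ev t).2, mem t⟩⟩, ?_⟩
  · exact ⟨a₀, ⟨⟨x₀, .pt, rfl⟩⟩⟩
  · rintro a a' ⟨x, t, ht⟩ ⟨y, t', ht'⟩
    refine ⟨bc ⟨a, x⟩ ⟨a', y⟩, ⟨bz ⟨a, x⟩ ⟨a', y⟩, .bin t t', ?_⟩, bf ⟨a, x⟩ ⟨a', y⟩, bg ⟨a, x⟩ ⟨a', y⟩,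
      Subtype.ext (hbf ⟨a, x⟩ ⟨a', y⟩), Subtype.ext (hbg ⟨a, x⟩ ⟨a', y⟩)⟩
    change (⟨bc (ev t) (ev t'), bz (ev t) (ev t')⟩ : Element W) = _
    rw [ht, ht']
  · rintro a a' f g ⟨y, t, ht⟩ h
    obtain ⟨k, hk, hk'⟩ := heq ⟨_, _, f, g⟩ y (congrArg Subtype.val h)
    refine ⟨_, ⟨(eq ⟨_, _, f, g⟩ ⟨_, y⟩).2, .un (.inr ⟨_, _, f, g⟩) t, ?_⟩, k,
      Subtype.ext hk, hk'⟩
    change eq _ (ev t) = _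
    rw [ht]
  · rintro ⟨a, x, t, ht⟩
    refine ⟨t, ?_⟩
    -- Generalizing `ev t` to a variable lets the equality of dependent pairs be eliminated by
    -- substitution.
    have : ∀ (z : Element W) (hz : z.2 ∈ W'.obj (op z.1)) (hx : x ∈ W'.obj (op a)), z = ⟨a, x⟩ →
        (⟨z.1, ⟨z.2, hz⟩⟩ : Element W'.toFunctor) = ⟨a, ⟨x, hx⟩⟩ := by
      rintro _ hz hx rfl
      rfl
    exact this _ _ _ ht

variable (A) in
/-- Presheaves whose values are subsets of a given set. -/
structure SubsetPresheaf (M : Type w) : Type w where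
  obj : A → Set M
  map {a b : A} : (a ⟶ b) → obj b → obj a
  map_id (a : A) (x : obj a) : map (𝟙 a) x = x
  map_comp {a b c : A} (f : a ⟶ b) (g : b ⟶ c) (x : obj c) : map (f ≫ g) x = map f (map g x)

/-- The underlying presheaf of a `SubsetPresheaf`. -/
def SubsetPresheaf.toFunctor {M : Type w} (m : SubsetPresheaf A M) : Aᵒᵖ ⥤ Type w where
  obj a := m.obj a.unop
  map f := ↾(m.map f.unop)
  map_id a := by ext x; exact congrArg _ (m.map_id _ x)
  map_comp f g := by ext x; exact congrArg _ (m.map_comp _ _ x)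

/-- Choosing a preimage under `s` of each element embeds every value of `W` into `M`. Hence the
presheaves covered by `M` form a small set up to isomorphism. -/
lemma exists_subsetPresheaf (W : Aᵒᵖ ⥤ Type w) {M : Type w} (s : M → Element W)
    (hs : Function.Surjective s) : ∃ m : SubsetPresheaf A M, Nonempty (m.toFunctor ≅ W) := by
  have inj (a : A) : Function.Injective fun x : W.obj (op a) ↦ Function.surjInv hs ⟨a, x⟩ :=
    fun x y h ↦ by simpa using Function.injective_surjInv hs h
  let e (a : A) := Equiv.ofInjective _ (inj a)
  let m : SubsetPresheaf A M :=
    { obj a := Set.range fun x : W.obj (op a) ↦ Function.surjInv hs ⟨a, x⟩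
      map {a b} f x := e a (W.map f.op ((e b).symm x))
      map_id a x := by simp
      map_comp f g x := by simp }
  exact ⟨m, ⟨NatIso.ofComponents (fun a ↦ (e a.unop).symm.toIso) (fun f ↦ by
    ext x
    exact (e _).symm_apply_apply _)⟩⟩

/-- Given products, a weak colimit is the product of a small weakly initial family of cocones. -/
lemma exists_weakColimit {C : Type u} [Category.{v} C] [HasProducts.{w} C] {J : Type u'}
    [Category.{v'} J] {D : J ⥤ C} {T : Type w} (c : T → Cocone D)
    (hc : ∀ s : Cocone D, ∃ t, Nonempty (c t ⟶ s)) :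
    ∃ c : Cocone D, ∀ s : Cocone D, Nonempty (c ⟶ s) := by
  refine ⟨{ pt := ∏ᶜ fun t ↦ (c t).pt
            ι := { app j := Pi.lift fun t ↦ (c t).ι.app j
                   naturality i j f := ?_ } }, fun s ↦ ?_⟩
  · refine Limits.Pi.hom_ext _ _ fun t ↦ ?_
    simp
  · obtain ⟨t, ⟨f⟩⟩ := hc s
    exact ⟨{ hom := Pi.π _ t ≫ f.hom, w j := by simp }⟩

theorem hasWeakColimits_indObj [HasProducts.{w} (IndObj A)] : HasWeakColimits.{w} (IndObj A) := by
  intro J _ D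
  let T : Type w := Σ j : J, Element (D.obj j).obj
  -- The small solution set: all cocones whose point is carried by subsets of the set of terms.
  let S : Type w := Σ (m : {m : SubsetPresheaf A (Term T (UnaryOp A)) // IsIndObject m.toFunctor}),
    (D ⟶ (Functor.const J).obj (⟨m.1.toFunctor, m.2⟩ : IndObj A))
  refine exists_weakColimit (fun s : S ↦ ⟨_, s.2⟩) fun s ↦ ?_
  obtain ⟨W', hW', hmem, e, he⟩ := exists_flat_subfunctor
    ((isIndObject_iff_isFlat _).1 s.pt.property)
    (fun t : T ↦ ⟨t.2.1, (s.ι.app t.1).hom.app _ t.2.2⟩)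
  obtain ⟨m, ⟨i⟩⟩ := exists_subsetPresheaf _ e he
  have hm : IsIndObject m.toFunctor := ((isIndObject_iff_isFlat _).2 hW').map i.inv
  -- The legs land in `W'` because their values on elements are the constants from which `W'` is
  -- generated.
  have hfac (j : J) : ∃ g : (D.obj j).obj ⟶ W'.toFunctor, g ≫ W'.ι = (s.ι.app j).hom :=
    ⟨W'.lift (s.ι.app j).hom (by
      rintro ⟨a⟩ _ ⟨x, rfl⟩
      exact hmem ⟨j, a, x⟩), W'.lift_ι _ _⟩
  choose g hg using hfac
  refine ⟨⟨⟨m, hm⟩, { app j := ⟨g j ≫ i.inv⟩, naturality j j' f := ?_ }⟩,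
    ⟨{ hom := ⟨i.hom ≫ W'.ι⟩, w j := ?_ }⟩⟩
  · ext : 1
    have : (D.map f).hom ≫ g j' = g j := by
      rw [← cancel_mono W'.ι, Category.assoc, hg, hg, ← ObjectProperty.FullSubcategory.comp_hom,
        s.w f]
    simp [reassoc_of% this]
  · ext : 1
    simp [hg]

end

/-! ### Accessible predefinable categories are prelocalizations -/

section

variable {A : Type w} [SmallCategory A]

/-- Ind-objects are closed under products if products of representables are ind-objects. -/
lemma isClosedUnderLimitsOfShape_isIndObject {I : Type w}
    (h : ∀ g : I → A, IsIndObject (∏ᶜ yoneda.obj ∘ g)) :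
    ObjectProperty.IsClosedUnderLimitsOfShape (IsIndObject (C := A)) (Discrete I) :=
  .mk' (by
    rintro _ ⟨F, hF⟩
    exact isIndObject_limit_of_discrete h _ hF)

variable {C : Type u} [Category.{w} C] (G : A ⥤ C)

/-- If the target of a dense functor has products, then products of representables are
ind-objects. -/
lemma isIndObject_pi_yoneda [G.Full] [G.Faithful] [∀ X, IsFiltered (CostructuredArrow G X)] {I : Type w}
    [HasProductsOfShape I C] (g : I → A) : IsIndObject (∏ᶜ yoneda.obj ∘ g) :=
  -- The restricted Yoneda functor preserves products and sends `G a` to the representable at `a`.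
  (isIndObject_restrictedYoneda G (∏ᶜ fun i ↦ G.obj (g i))).map
    (PreservesProduct.iso (restrictedYoneda G) _ ≪≫
      Pi.mapIso fun i ↦ (compRestrictedYonedaIso G).app (g i)).hom

/-- The restricted Yoneda functor, with values in ind-objects. -/
abbrev indRestrictedYoneda [∀ X, IsFiltered (CostructuredArrow G X)] : C ⥤ IndObj A :=
  ObjectProperty.lift (IsIndObject (C := A)) (restrictedYoneda G)
    (fun _ ↦ isIndObject_restrictedYoneda G _)

variable [∀ X, IsFiltered (CostructuredArrow G X)]

/-- The restricted Yoneda functor extends the Yoneda embedding. -/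
noncomputable def compIndRestrictedYonedaIso [G.Full] [G.Faithful] :
    G ⋙ indRestrictedYoneda G ≅ IndObj.yoneda A :=
  NatIso.ofComponents (fun a ↦ ObjectProperty.isoMk _ ((compRestrictedYonedaIso G).app a))
    (fun f ↦ by
      ext : 1
      exact (compRestrictedYonedaIso G).hom.naturality f)

/-- The left adjoint is defined on the representable at `a`, with value `G a`. Its domain of
definition is closed under colimits available in `C`, and directed colimits of representables
exhaust the ind-objects. -/
lemma isRightAdjoint_indRestrictedYoneda [HasDirectedColimits.{w} C] :
    (indRestrictedYoneda G).IsRightAdjoint := by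
  refine Functor.isRightAdjoint_of_leftAdjointObjIsDefined_eq_top (le_antisymm le_top ?_)
  intro W _
  obtain ⟨J, _, _, _, Φ, c, rfl, ⟨hc⟩⟩ := W.exists_directed
  refine Functor.leftAdjointObjIsDefined_of_isColimit hc fun j ↦ ?_
  let e : indRestrictedYoneda G ⋙ coyoneda.obj (op ((IndObj.yoneda A).obj (Φ.obj j))) ≅
      coyoneda.obj (op (G.obj (Φ.obj j))) :=
    Functor.isoWhiskerLeft (indRestrictedYoneda G) (coyonedaObjYonedaIso (Φ.obj j))
  exact Functor.IsCorepresentable.mk' e.symm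

/-- Postcomposing a limit fan with isomorphisms. -/
def isLimitFanPostcomp {C : Type u} [Category.{v} C] {I : Type w} {X Y : I → C} {P : C}
    {p : ∀ i, P ⟶ X i} (h : IsLimit (Fan.mk P p)) (e : ∀ i, X i ≅ Y i) :
    IsLimit (Fan.mk P fun i ↦ p i ≫ (e i).hom) :=
  IsLimit.ofIsoLimit ((IsLimit.postcomposeHomEquiv (Discrete.natIso fun i ↦ e i.as :
      Discrete.functor X ≅ Discrete.functor Y) (Fan.mk P p)).symm h)
    (Cone.ext (Iso.refl _) fun _ ↦ (Category.id_comp _).symm)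

/-- If products distribute over directed colimits in `C`, then the reflector from ind-objects
preserves products. -/
theorem preservesLimitsOfShape_of_adjunction [G.Full] [G.Faithful] [G.IsDense]
    (hC : IsPredefinable.{w} C) {R : IndObj A ⥤ C} (adj : R ⊣ indRestrictedYoneda G)
    (I : Type w) : PreservesLimitsOfShape (Discrete I) R := by
  have := hC.hasDirectedColimits
  have : HasProductsOfShape I C := hC.hasProducts I
  have : ObjectProperty.IsClosedUnderLimitsOfShape (IsIndObject (C := A)) (Discrete I) :=
    isClosedUnderLimitsOfShape_isIndObject (isIndObject_pi_yoneda G)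
  have := adj.isLeftAdjoint
  have := adj.isRightAdjoint
  let ε : indRestrictedYoneda G ⋙ R ≅ 𝟭 C := asIso adj.counit
  have : PreservesLimitsOfShape (Discrete I) (indRestrictedYoneda G ⋙ R) :=
    preservesLimitsOfShape_of_natIso ε.symm
  suffices ∀ (W : I → IndObj A), PreservesLimit (Discrete.functor W) R from
    ⟨fun {K} ↦ preservesLimit_of_iso_diagram R Discrete.natIsoFunctor.symm⟩
  intro W
  choose J _ _ _ Φ c hc hc' using fun i ↦ (W i).exists_directed
  obtain rfl : (fun i ↦ (c i).pt) = W := funext hc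
  let β := compIndRestrictedYonedaIso G
  let γ : IndObj.yoneda A ⋙ R ≅ G :=
    Functor.isoWhiskerRight β.symm R ≪≫ Functor.isoWhiskerLeft G ε
  let F (i : I) : J i ⥤ C := Φ i ⋙ G
  let d₀ : ProductCocone F := ProductCocone.canonical _ fun i ↦ colimit.isColimit (F i)
  -- The products of representables are taken as images of products in `C`, so that `R` gives back
  -- the latter.
  let d : ProductCocone fun i ↦ Φ i ⋙ IndObj.yoneda A :=
    ProductCocone.ofFan (d₀.P ⋙ indRestrictedYoneda G)
      (fun k i ↦ (indRestrictedYoneda G).map (d₀.π k i) ≫ β.hom.app ((Φ i).obj (k i)))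
      (fun {k l} f i ↦ by
        have h := β.hom.naturality ((Φ i).map (f i))
        rw [Functor.comp_map, ← Category.assoc, ← Functor.map_comp, d₀.map_π, Functor.map_comp,
          Category.assoc, Category.assoc]
        exact congrArg _ h)
      (fun k ↦ isLimitFanPostcomp (isLimitFanMkObjOfIsLimit (indRestrictedYoneda G) _ _
        (d₀.isLimit k)) fun i ↦ β.app ((Φ i).obj (k i)))
      c (fun i ↦ (hc' i).some) (limit.cone _) (limit.isLimit _)
  obtain ⟨hd⟩ := ProductCocone.nonempty_isColimit_of_fullyFaithful (IndObj.inclusion A) d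
    (productIsProduct _)
  -- `R` preserves these particular products because its composite with the embedding is isomorphic
  -- to the identity.
  let d' := d.postcomp R fun k ↦ by
    have h := isLimitFanPostcomp (isLimitFanMkObjOfIsLimit (indRestrictedYoneda G ⋙ R) _ _
      (d₀.isLimit k)) fun i ↦ R.mapIso (β.app ((Φ i).obj (k i)))
    have e (i : I) : R.map (d.π k i) =
      (indRestrictedYoneda G ⋙ R).map (d₀.π k i) ≫ (R.mapIso (β.app ((Φ i).obj (k i)))).hom :=
        R.map_comp _ _
    rw [funext e]
    exact h
  have hd' : IsColimit d'.cocone :=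
    IsColimit.ofIsoColimit (isColimitOfPreserves R hd) (d.postcompCoconeIso R _)
  obtain ⟨h⟩ := ProductCocone.isColimit_canonical_iff.2 (hC.isIso_canonical I J F)
  -- Both cocones are colimits: one because `R` is a left adjoint, the other by distributivity in
  -- `C`. Hence the image of the product fan is a limit.
  obtain ⟨h'⟩ := ProductCocone.nonempty_isLimit (d := d')
    (fun i ↦ Functor.isoWhiskerLeft (Φ i) γ) (ProductCocone.isLimitCanonicalFan _ _) hd' h
  exact preservesLimit_of_preserves_limit_cone (productIsProduct _)
    ((isLimitMapConeFanMkEquiv R _ _).symm h')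

variable (C) in
theorem exists_isCompletePrelocalization [IsAccessibleCategory.{w} C]
    (hC : IsPredefinable.{w} C) :
    ∃ (K : Type (w + 1)) (_ : LargeCategory.{w} K) (i : C ⥤ K),
      IsWeaklyLocallyFinitelyPresentable.{w} K ∧ IsCompletePrelocalization.{w} i := by
  obtain ⟨κ, _, _⟩ := IsAccessibleCategory.exists_cardinal C
  obtain ⟨A, _, G, _, _, _, _, _⟩ := exists_dense_functor C κ
  have := hC.hasDirectedColimits
  have (I : Type w) : HasProductsOfShape I C := hC.hasProducts I
  have (I : Type w) :
      ObjectProperty.IsClosedUnderLimitsOfShape (IsIndObject (C := A)) (Discrete I) :=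
    isClosedUnderLimitsOfShape_isIndObject (isIndObject_pi_yoneda G)
  have : HasProducts.{w} (IndObj A) := fun I ↦ inferInstance
  have := isRightAdjoint_indRestrictedYoneda G
  exact ⟨IndObj A, inferInstance, indRestrictedYoneda G,
    ⟨isFinitelyAccessibleCategory_indObj A, hasWeakColimits_indObj⟩,
    { L := (indRestrictedYoneda G).leftAdjoint
      adj := Adjunction.ofIsRightAdjoint _ },
    fun I ↦ preservesLimitsOfShape_of_adjunction G hC (Adjunction.ofIsRightAdjoint _) I⟩

end

/-! ### Prelocalizations are predefinable -/

section

variable {A : Type w} [SmallCategory A] {C : Type u} [Category.{w} C] (G : A ⥤ C)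
  [G.Full] [G.Faithful]

/-- If the target of a dense functor has weak colimits, then products of representables are
ind-objects. -/
lemma isIndObject_pi_yoneda_of_hasWeakColimits [∀ X, IsFiltered (CostructuredArrow G X)]
    (hC : HasWeakColimits.{w} C) {I : Type w} (g : I → A) :
    IsIndObject (∏ᶜ yoneda.obj ∘ g) := by
  rw [isIndObject_iff]
  have := essentiallySmallSelf (CostructuredArrow yoneda (∏ᶜ yoneda.obj ∘ g))
  -- It suffices to find a cocone on each finite diagram of elements, that is, of families of maps
  -- into the `g i`.
  refine ⟨IsFiltered.of_cocone_nonempty.{w} _ fun {J} _ _ D ↦ ?_,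
    finallySmall_of_essentiallySmall _⟩
  let D' : J ⥤ A := D ⋙ CostructuredArrow.proj _ _
  let u (j : J) (i : I) : D'.obj j ⟶ g i :=
    yoneda.preimage ((D.obj j).hom ≫ Pi.π (yoneda.obj ∘ g) i)
  have hu (j : J) (i : I) : yoneda.map (u j i) = (D.obj j).hom ≫ Pi.π (yoneda.obj ∘ g) i :=
    yoneda.map_preimage _
  let s (i : I) : Cocone (D' ⋙ G) :=
    { pt := G.obj (g i)
      ι := { app j := G.map (u j i)
             naturality j j' f := by
              refine Eq.trans ?_ (Category.comp_id _).symm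
              refine (G.map_comp _ _).symm.trans (congrArg G.map (yoneda.map_injective ?_))
              rw [Functor.map_comp, hu, hu]
              exact (Category.assoc _ _ _).symm.trans
                (congrArg (· ≫ _) (CostructuredArrow.w (D.map f))) } }
  -- One weak colimit serves all `i` at once; only existence of the factorizations is needed.
  obtain ⟨c, hc⟩ := hC J (D' ⋙ G)
  let m (i : I) : c ⟶ s i := (hc (s i)).some
  let E : J ⥤ CostructuredArrow G c.pt :=
    { obj j := CostructuredArrow.mk (c.ι.app j)
      map f := CostructuredArrow.homMk (D'.map f) (c.w f) }
  -- Filteredness over `c.pt` factors the legs of `c` through a single `G a`, bringing the cocone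
  -- back into `A`.
  obtain ⟨t⟩ := IsFiltered.cocone_nonempty E
  let n (i : I) : t.pt.left ⟶ g i := G.preimage (t.pt.hom ≫ (m i).hom)
  have hn (j : J) (i : I) : (t.ι.app j).left ≫ n i = u j i := by
    apply G.map_injective
    have h1 : G.map (t.ι.app j).left ≫ t.pt.hom = c.ι.app j := CostructuredArrow.w (t.ι.app j)
    have h2 : c.ι.app j ≫ (m i).hom = G.map (u j i) := (m i).w j
    rw [G.map_comp, G.map_preimage, reassoc_of% h1, h2]
  exact ⟨{
    pt := CostructuredArrow.mk (Y := t.pt.left) (Pi.lift fun i ↦ yoneda.map (n i))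
    ι := { app j := CostructuredArrow.homMk (t.ι.app j).left (by
             refine Limits.Pi.hom_ext _ _ fun i ↦ ?_
             rw [← hu, ← hn, Functor.map_comp]
             exact (Category.assoc _ _ _).trans
               (congrArg (yoneda.map _ ≫ ·) (limit.lift_π _ _)))
           naturality j j' f := by
             ext : 1
             have h : (D.map f).left ≫ (t.ι.app j').left = (t.ι.app j).left ≫ 𝟙 _ :=
               congrArg CommaMorphism.left (t.ι.naturality f)
             exact h } }⟩

/-- Any ind-object is in the essential image of the restricted Yoneda functor, if the latter
preserves filtered colimits. -/
lemma exists_restrictedYoneda_iso [HasFilteredColimitsOfSize.{w, w} C]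
    (hG : ∀ (J : Type w) [SmallCategory J] [IsFiltered J],
      PreservesColimitsOfShape J (restrictedYoneda G))
    {W : Aᵒᵖ ⥤ Type w} (hW : IsIndObject W) :
    ∃ X, Nonempty ((restrictedYoneda G).obj X ≅ W) := by
  obtain ⟨p⟩ := hW.nonempty_presentation
  have := hG p.I
  exact ⟨colimit (p.F ⋙ G), ⟨IsColimit.coconePointsIsoOfNatIso
    (isColimitOfPreserves (restrictedYoneda G) (colimit.isColimit (p.F ⋙ G)))
    p.coconeIsColimit (Functor.isoWhiskerLeft p.F (compRestrictedYonedaIso G))⟩⟩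

end

attribute [local instance] Cardinal.fact_isRegular_aleph0

variable {K : Type u} [Category.{w} K]

lemma IsWeaklyLocallyFinitelyPresentable.hasFilteredColimits
    (hK : IsWeaklyLocallyFinitelyPresentable.{w} K) : HasFilteredColimitsOfSize.{w, w} K := by
  have := hK.isFinitelyAccessible
  refine ⟨fun J _ _ ↦ ?_⟩
  have := (isCardinalFiltered_aleph0_iff.{w} J).2 inferInstance
  exact HasCardinalFilteredColimits.hasColimitsOfShape K Cardinal.aleph0 J

/-- A weakly locally finitely presentable category embeds into presheaves, as a subcategory closed
under products and filtered colimits. -/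
lemma IsWeaklyLocallyFinitelyPresentable.exists_embedding
    (hK : IsWeaklyLocallyFinitelyPresentable.{w} K) :
    HasProducts.{w} K ∧ ∃ (A : Type w) (_ : SmallCategory A) (E : K ⥤ Aᵒᵖ ⥤ Type w),
      E.Full ∧ E.Faithful ∧ (∀ I : Type w, PreservesLimitsOfShape (Discrete I) E) ∧
        ∀ (J : Type w) [SmallCategory J] [IsFiltered J], PreservesColimitsOfShape J E := by
  have := hK.isFinitelyAccessible
  have := hK.hasFilteredColimits
  obtain ⟨A, _, G, _, _, _, hG, _⟩ := exists_dense_functor K Cardinal.aleph0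
  have pres (J : Type w) [SmallCategory J] [IsFiltered J] :
      PreservesColimitsOfShape J (restrictedYoneda G) := by
    have := (isCardinalFiltered_aleph0_iff.{w} J).2 inferInstance
    have (a : A) := preservesColimitsOfShape_of_isCardinalPresentable (G.obj a) Cardinal.aleph0 J
    exact preservesColimitsOfShape_restrictedYoneda G J
  refine ⟨fun I ↦ ⟨fun F ↦ ?_⟩, A, inferInstance, restrictedYoneda G, inferInstance,
    inferInstance, fun I ↦ inferInstance, fun J _ _ ↦ pres J⟩
  -- The product computed in presheaves is an ind-object, so it lies in the essential image and the
  -- fully faithful embedding creates it.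
  have h : IsIndObject (limit (F ⋙ restrictedYoneda G)) := isIndObject_limit_of_discrete
    (isIndObject_pi_yoneda_of_hasWeakColimits G hK.hasWeakColimits) _
      fun i ↦ isIndObject_restrictedYoneda G (F.obj i)
  obtain ⟨X, ⟨e⟩⟩ := exists_restrictedYoneda_iso G pres h
  have := createsLimitOfFullyFaithfulOfIso X e
  exact hasLimit_of_created F (restrictedYoneda G)

/-- Distributivity in `K` is inherited from presheaves. The reflector preserves the products and
colimits involved, and the invertible counit identifies the reflected diagrams with those in `L`. -/
theorem IsCompletePrelocalization.isPredefinable {L : Type u'} [Category.{v'} L] {i : L ⥤ K}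
    (hi : IsCompletePrelocalization.{w} i) (hK : IsWeaklyLocallyFinitelyPresentable.{w} K) :
    IsPredefinable.{w} L := by
  obtain ⟨_, hR⟩ := hi
  obtain ⟨_, A, _, E, _, _, _, _⟩ := hK.exists_embedding
  have := hK.hasFilteredColimits
  have hL (I : Type w) : HasProductsOfShape I L := hasLimitsOfShape_of_reflective i
  have hD : HasDirectedColimits.{w} L := ⟨fun J _ _ _ ↦ hasColimitsOfShape_of_reflective i⟩
  refine ⟨hL, hD, fun I J _ _ _ F ↦ ?_⟩
  let d : ProductCocone fun j ↦ F j ⋙ i :=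
    ProductCocone.canonical _ fun j ↦ colimit.isColimit (F j ⋙ i)
  obtain ⟨hd⟩ := ProductCocone.nonempty_isColimit_of_fullyFaithful E d
    (ProductCocone.isLimitCanonicalFan _ _)
  let d' := d.postcomp (reflector i) fun k ↦ isLimitFanMkObjOfIsLimit _ _ _ (d.isLimit k)
  have hd' : IsColimit d'.cocone :=
    IsColimit.ofIsoColimit (isColimitOfPreserves (reflector i) hd) (d.postcompCoconeIso _ _)
  rw [← ProductCocone.isColimit_canonical_iff]
  exact ProductCocone.nonempty_isColimit (d := d')
    (fun j ↦ Functor.isoWhiskerLeft (F j) (asIso (reflectorAdjunction i).counit))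
    (isLimitFanMkObjOfIsLimit (reflector i) _ _ (ProductCocone.isLimitCanonicalFan _ _))
    (ProductCocone.isLimitCanonicalFan _ _) hd'

end Predefinable

theorem theorem2p2p5 (L : Type u) [Category.{w} L] :
    (IsAccessibleCategory.{w} L ∧ Predefinable.IsPredefinable.{w} L) ↔
      (IsAccessibleCategory.{w} L ∧
        ∃ (K : Type (w + 1)) (_ : LargeCategory.{w} K) (i : L ⥤ K),
          Predefinable.IsWeaklyLocallyFinitelyPresentable.{w} K ∧
            Predefinable.IsCompletePrelocalization.{w} i) := by
  constructor
  · rintro ⟨_, hL⟩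
    exact ⟨inferInstance, Predefinable.exists_isCompletePrelocalization L hL⟩
  · rintro ⟨h, K, _, i, hK, hi⟩
    exact ⟨h, hi.isPredefinable hK⟩
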